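/- Let $G$ be a countable torsion-free abelian group. A $G$-system $X=(X,\mu,(T_g)_{g\in G})$ consists of a compact metric space $X$, a Borel probability measure $\mu$ on $X$, and an action of $G$ on $X$ by $\mu$-preserving transformations $T_g$ (measurable for the $\mu$-completion of the Borel $\sigma$-algebra). It is ergodic if every measurable set $A$ such that $T_g^{-1}A=A$ up to a $\mu$-null set for all $g\in G$ has measure $0$ or $1$. For $P:X\to S^1$ put $\Delta_gP(x)=P(T_gx)\overline{P(x)}$. For $i\ge 1$ the $i$-th spectrum $\mathrm{Spec}_i(X)$ is the group, under pointwise multiplication, of all functions $\lambda:G^i\to S^1$ for which there is a measurable $P:X\to S^1$ such that, for all $g_1,\dots,g_{i+1}\in G$, $\Delta_{g_1}\cdots\Delta_{g_{i+1}}P=1$ and $\Delta_{g_1}\cdots\Delta_{g_i}P=\lambda(g_1,\dots,g_i)$ $\mu$-almost everywhere. An extension of $X$ is a $G$-system $Y=(Y,\nu,(S_g)_{g\in G})$ with a factor map $\pi:Y\to X$, that is, a measurable, measure-preserving, surjective map with $\pi\circ S_g=T_g\circ\pi$ for all $g\in G$. It induces the natural inclusion $\mathrm{Spec}_i(X)\hookrightarrow\mathrm{Spec}_i(Y)$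 which sends $\lambda=\Delta_{g_1}\cdots\Delta_{g_i}P$ to $\Delta_{g_1}\cdots\Delta_{g_i}(P\circ\pi)$; as functions on $G^i$ the two are equal. Theorem. Let $k\ge 2$. Then every ergodic $G$-system $X$ has an ergodic extension $Y$ (again a $G$-system) in which $X$ is $k$-divisible: for every $1\le i\le k-1$, every $\lambda\in\mathrm{Spec}_i(X)$ and every integer $n\ge 1$ there is $\gamma\in\mathrm{Spec}_i(Y)$ such that $\gamma^n$ is the image of $\lambda$ under the natural inclusion $\mathrm{Spec}_i(X)\hookrightarrow\mathrm{Spec}_i(Y)$. -/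

import Mathlib

open MeasureTheory Filter

universe u v

/-- A measure preserving `G`-system `(X, μ, (T_g))`: a compact metric space with its Borel
`σ`-algebra, a Borel probability measure, and an action of `G` by measure preserving
transformations `T_g x = g +ᵥ x`. Each `T_g` is only required to be measurable for the
completion of the Borel `σ`-algebra, which on a compact metric space is `AEMeasurable`. -/
structure GSystem (G : Type v) [AddCommGroup G] where
  carrier : Type u
  [metric : MetricSpace carrier]
  [compact : CompactSpace carrier]
  [meas : MeasurableSpace carrier]
  [borel : BorelSpace carrier]
  [action : AddAction G carrier]
  μ : Measure carrier
  [prob : IsProbabilityMeasure μ]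
  aemeasurable_vadd : ∀ g : G, AEMeasurable (fun x : carrier => g +ᵥ x) μ
  map_vadd : ∀ g : G, μ.map (fun x : carrier => g +ᵥ x) = μ

noncomputable section

namespace GSystem

attribute [instance] GSystem.metric GSystem.compact GSystem.meas GSystem.borel
  GSystem.action GSystem.prob

variable {G : Type v} [AddCommGroup G]

/-- Every measurable set that is almost invariant under each `T_g` is null or conull. -/
def Ergodic (X : GSystem.{u} G) : Prop :=
  ErgodicVAdd G X.carrier X.μ

/-- The multiplicative derivative `Δ_g P (x) = P (T_g x) · conj (P x)`; on the circle, complex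
conjugation is inversion. -/
def mulDeriv (X : GSystem.{u} G) (g : G) (P : X.carrier → Circle) : X.carrier → Circle :=
  fun x => P (g +ᵥ x) * (P x)⁻¹

/-- The iterated derivative `Δ_{g 0} Δ_{g 1} ⋯ Δ_{g (k-1)} P`. -/
def iterDeriv (X : GSystem.{u} G) :
    (k : ℕ) → (Fin k → G) → (X.carrier → Circle) → X.carrier → Circle
  | 0, _, P => P
  | k + 1, g, P => X.mulDeriv (g 0) (X.iterDeriv k (Fin.tail g) P)

/-- `P : X → S¹` is a phase polynomial of degree `< k`: it is measurable (for the completion;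
on the separable metrizable space `S¹` this is `AEStronglyMeasurable`) and `Δ_{g₁} ⋯ Δ_{g_k} P = 1` almost everywhere, for all `g₁, …, g_k`. -/
def IsPhasePoly (X : GSystem.{u} G) (k : ℕ) (P : X.carrier → Circle) : Prop :=
  AEStronglyMeasurable P X.μ ∧ ∀ g : Fin k → G, X.iterDeriv k g P =ᵐ[X.μ] fun _ => 1

theorem iterDeriv_one (X : GSystem.{u} G) (k : ℕ) (g : Fin k → G) :
    X.iterDeriv k g (fun _ => 1) = fun _ => 1 := by
  induction k with
  | zero => rfl
  | succ k ih => funext x; simp [iterDeriv, mulDeriv, ih]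

theorem iterDeriv_mul (X : GSystem.{u} G) (k : ℕ) (g : Fin k → G) (P Q : X.carrier → Circle) :
    X.iterDeriv k g (fun x => P x * Q x)
      = fun x => X.iterDeriv k g P x * X.iterDeriv k g Q x := by
  induction k with
  | zero => rfl
  | succ k ih =>
    funext x
    simp only [iterDeriv, mulDeriv, ih, mul_inv]
    exact mul_mul_mul_comm _ _ _ _

theorem iterDeriv_inv (X : GSystem.{u} G) (k : ℕ) (g : Fin k → G) (P : X.carrier → Circle) :
    X.iterDeriv k g (fun x => (P x)⁻¹) = fun x => (X.iterDeriv k g P x)⁻¹ := by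
  induction k with
  | zero => rfl
  | succ k ih => funext x; simp only [iterDeriv, mulDeriv, ih, mul_inv]

/-- The `k`-th spectrum: the group (under pointwise multiplication) of all `λ : G^k → S¹` for
which there is a phase polynomial `P` of degree `< k + 1` with
`Δ_{g₁} ⋯ Δ_{g_k} P = λ (g₁, …, g_k)` almost everywhere, for all `g₁, …, g_k`. -/
def Spec (X : GSystem.{u} G) (k : ℕ) : Subgroup ((Fin k → G) → Circle) where
  carrier := {l | ∃ P : X.carrier → Circle, X.IsPhasePoly (k + 1) P ∧
    ∀ g : Fin k → G, X.iterDeriv k g P =ᵐ[X.μ] fun _ => l g}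
  one_mem' := ⟨fun _ => 1, ⟨aestronglyMeasurable_const, fun g => by rw [iterDeriv_one]⟩,
    fun g => by rw [iterDeriv_one]; rfl⟩
  mul_mem' := by
    rintro a b ⟨P, ⟨hP, hP1⟩, hPa⟩ ⟨Q, ⟨hQ, hQ1⟩, hQb⟩
    refine ⟨fun x => P x * Q x, ⟨hP.mul hQ, fun g => ?_⟩, fun g => ?_⟩
    · rw [iterDeriv_mul]
      filter_upwards [hP1 g, hQ1 g] with x h1 h2
      simp [h1, h2]
    · rw [iterDeriv_mul]
      filter_upwards [hPa g, hQb g] with x h1 h2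
      simp [h1, h2]
  inv_mem' := by
    rintro a ⟨P, ⟨hP, hP1⟩, hPa⟩
    refine ⟨fun x => (P x)⁻¹, ⟨hP.inv, fun g => ?_⟩, fun g => ?_⟩
    · rw [iterDeriv_inv]
      filter_upwards [hP1 g] with x h1
      simp [h1]
    · rw [iterDeriv_inv]
      filter_upwards [hPa g] with x h1
      simp [h1]

/-- A factor map `π : Y → X` of `G`-systems: a measure preserving map of `Y` onto `X` with
`π ∘ S_g = T_g ∘ π` for all `g`. A system `Y` with such a map is an extension of `X`. -/
structure FactorMap (Y X : GSystem.{u} G) where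
  toFun : Y.carrier → X.carrier
  aemeasurable : AEMeasurable toFun Y.μ
  map_eq : Y.μ.map toFun = X.μ
  surjective : Function.Surjective toFun
  equivariant : ∀ (g : G) (y : Y.carrier), toFun (g +ᵥ y) = g +ᵥ toFun y

namespace FactorMap

variable {Y X : GSystem.{u} G}

theorem iterDeriv_comp (π : FactorMap Y X) (k : ℕ) (g : Fin k → G) (P : X.carrier → Circle) :
    Y.iterDeriv k g (P ∘ π.toFun) = X.iterDeriv k g P ∘ π.toFun := by
  induction k with
  | zero => rfl
  | succ k ih =>
    funext y
    simp only [iterDeriv, mulDeriv, ih, Function.comp_apply, π.equivariant]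

theorem ae_comp (π : FactorMap Y X) {p : X.carrier → Prop}
    (h : ∀ᵐ x ∂X.μ, p x) : ∀ᵐ y ∂Y.μ, p (π.toFun y) := by
  rw [← π.map_eq] at h
  exact ae_of_ae_map π.aemeasurable h

theorem isPhasePoly_comp (π : FactorMap Y X) {k : ℕ} {P : X.carrier → Circle}
    (hP : X.IsPhasePoly k P) : Y.IsPhasePoly k (P ∘ π.toFun) := by
  refine ⟨?_, fun g => ?_⟩
  · have h := hP.1
    rw [← π.map_eq] at h
    exact h.comp_aemeasurable π.aemeasurable
  · rw [iterDeriv_comp]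
    exact π.ae_comp (hP.2 g)

theorem spec_le (π : FactorMap Y X) (k : ℕ) : X.Spec k ≤ Y.Spec k := by
  rintro l ⟨P, hP, hl⟩
  refine ⟨P ∘ π.toFun, π.isPhasePoly_comp hP, fun g => ?_⟩
  rw [iterDeriv_comp]
  exact π.ae_comp (hl g)

/-- The natural inclusion `Spec_k(X) → Spec_k(Y)` induced by a factor map `π : Y → X`. It sends
`λ = Δ_{g₁} ⋯ Δ_{g_k} P` to `Δ_{g₁} ⋯ Δ_{g_k} (P ∘ π)` (see `specInclusion_spec`), which as a
function on `G^k` is `λ` again. -/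
def specInclusion (π : FactorMap Y X) (k : ℕ) : X.Spec k →* Y.Spec k :=
  Subgroup.inclusion (π.spec_le k)

theorem specInclusion_spec (π : FactorMap Y X) (k : ℕ) (l : X.Spec k) (P : X.carrier → Circle)
    (hP : ∀ g : Fin k → G, X.iterDeriv k g P =ᵐ[X.μ] fun _ => l.1 g) (g : Fin k → G) :
    Y.iterDeriv k g (P ∘ π.toFun) =ᵐ[Y.μ] fun _ => (π.specInclusion k l).1 g := by
  rw [iterDeriv_comp]
  exact π.ae_comp (hP g)

/-- `X` is `k`-divisible in its extension `Y`: for every `1 ≤ i ≤ k - 1`, the image in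
`Spec_i(Y)` of each element of `Spec_i(X)` has an `n`-th root in `Spec_i(Y)`, for all `n ≥ 1`. -/
def IsDivisibleIn (π : FactorMap Y X) (k : ℕ) : Prop :=
  ∀ i : ℕ, 1 ≤ i → i < k → ∀ n : ℕ, 1 ≤ n → ∀ l : X.Spec i,
    ∃ r : Y.Spec i, r ^ n = π.specInclusion i l

end FactorMap

end GSystem

end

/-! Along a generic orbit, a phase polynomial on `X` with symbol `λ` becomes a polynomial map `p : G
→ S¹` with the same symbol (`exists_iterDiff_eq`). Since `G` is torsion-free, `p` has an `n`-th root
`q` among polynomial maps of the same degree (`IsPolyMap.hasRoots`): on `ℤ^d` the root is obtained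
by discrete integration, and the general case follows by compactness. The symbol of `q` is an `n`-th
root of `λ`, and it remains to realise it in an ergodic extension of `X`.

Only countably many triples `(i, λ, n)` occur, because distinct symbols of positive degree force
their phase polynomials to be uniformly separated in `L¹` (`countable_spec`). All the roots `q t`
are therefore handled by one metrizable system (`exists_polynomial_system`): the compact group of
sequences `r` with `r t` a polynomial map of degree one less than `q t`, acted on so that `r t * q
t` is translated. Evaluation of `r t * q t` at `0` is a phase polynomial with the symbol of `q t`,
since `r t` contributes nothing to the top derivative (`symbol_mem_spec`).

This system need not be ergodic. An extreme point of the compact convex set of its joinings with `X`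
is ergodic (`exists_ergodic_joining`), and the phase polynomials pull back to it. -/

/-! ### Polynomial maps on abelian groups. -/

/-- The multiplicative difference `x ↦ f (g + x) * (f x)⁻¹` of a function on an additive group. -/
def mulDiff {G C : Type*} [AddCommGroup G] [CommGroup C] (g : G) (f : G → C) : G → C :=
  fun x => f (g + x) * (f x)⁻¹

/-- `f : G → C` is a polynomial map of degree `< m`: all its `m`-fold differences are trivial. -/
def IsPolyMap {G C : Type*} [AddCommGroup G] [CommGroup C] : ℕ → (G → C) → Prop
  | 0, f => f = 1
  | m + 1, f => ∀ g, IsPolyMap m (mulDiff g f)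

namespace IsPolyMap

variable {G H C : Type*} [AddCommGroup G] [AddCommGroup H] [CommGroup C]

theorem mulDiff_one (g : G) : mulDiff g (1 : G → C) = 1 := by
  funext x; simp [mulDiff]

theorem mulDiff_mul (g : G) (f k : G → C) : mulDiff g (f * k) = mulDiff g f * mulDiff g k := by
  funext x
  simp only [mulDiff, Pi.mul_apply, mul_inv]
  exact mul_mul_mul_comm _ _ _ _

theorem mulDiff_inv (g : G) (f : G → C) : mulDiff g f⁻¹ = (mulDiff g f)⁻¹ := by
  funext x
  simp [mulDiff, mul_comm]

theorem mulDiff_pow (g : G) (f : G → C) (n : ℕ) : mulDiff g (f ^ n) = mulDiff g f ^ n := by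
  funext x
  simp [mulDiff, mul_pow]

theorem mulDiff_comm (g h : G) (f : G → C) :
    mulDiff g (mulDiff h f) = mulDiff h (mulDiff g f) := by
  funext x
  simp only [mulDiff, mul_inv, inv_inv, add_left_comm g h x]
  rw [mul_mul_mul_comm, mul_comm (f (g + x))⁻¹, mul_mul_mul_comm]

theorem mulDiff_comp_add_hom (φ : H →+ G) (a : G) (g : H) (f : G → C) :
    mulDiff g (fun x => f (a + φ x)) = fun x => mulDiff (φ g) f (a + φ x) := by
  funext x
  simp [mulDiff, add_left_comm]

protected theorem one (m : ℕ) : IsPolyMap m (1 : G → C) := by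
  induction m with
  | zero => rfl
  | succ m ih => intro g; rwa [mulDiff_one]

protected theorem mul {m : ℕ} {f k : G → C} (hf : IsPolyMap m f) (hk : IsPolyMap m k) :
    IsPolyMap m (f * k) := by
  induction m generalizing f k with
  | zero => simp_all [IsPolyMap]
  | succ m ih => intro g; rw [mulDiff_mul]; exact ih (hf g) (hk g)

protected theorem inv {m : ℕ} {f : G → C} (hf : IsPolyMap m f) : IsPolyMap m f⁻¹ := by
  induction m generalizing f with
  | zero => simp_all [IsPolyMap]
  | succ m ih => intro g; rw [mulDiff_inv]; exact ih (hf g)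

theorem comp_add_hom {m : ℕ} {f : G → C} (hf : IsPolyMap m f) (φ : H →+ G) (a : G) :
    IsPolyMap m (fun x => f (a + φ x)) := by
  induction m generalizing f with
  | zero => simp only [IsPolyMap] at hf ⊢; subst hf; rfl
  | succ m ih => intro g; rw [mulDiff_comp_add_hom]; exact ih (hf (φ g))

theorem comp_hom {m : ℕ} {f : G → C} (hf : IsPolyMap m f) (φ : H →+ G) :
    IsPolyMap m (fun x => f (φ x)) := by
  simpa using hf.comp_add_hom φ 0

theorem comp_add {m : ℕ} {f : G → C} (hf : IsPolyMap m f) (a : G) :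
    IsPolyMap m (fun x => f (a + x)) :=
  hf.comp_add_hom (AddMonoidHom.id G) a

theorem mulDiff_zero (f : G → C) : mulDiff 0 f = 1 := by
  funext x; simp [mulDiff]

theorem mulDiff_add (g h : G) (f : G → C) :
    mulDiff (g + h) f = (fun x => mulDiff g f (h + x)) * mulDiff h f := by
  funext x
  simp [mulDiff, add_assoc]

theorem mulDiff_neg (g : G) (f : G → C) :
    mulDiff (-g) f = (fun x => mulDiff g f (-g + x))⁻¹ := by
  funext x
  simp [mulDiff]

/-- The elements whose difference lowers a map to degree `< m` form a subgroup. -/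
def diffSubgroup (m : ℕ) (f : G → C) : AddSubgroup G where
  carrier := {g | IsPolyMap m (mulDiff g f)}
  zero_mem' := by
    rw [Set.mem_ofPred_eq, mulDiff_zero]
    exact .one m
  add_mem' {a b} ha hb := by
    rw [Set.mem_ofPred_eq, mulDiff_add]
    exact (IsPolyMap.comp_add ha b).mul hb
  neg_mem' {a} ha := by
    rw [Set.mem_ofPred_eq, mulDiff_neg]
    exact (IsPolyMap.comp_add ha (-a)).inv

theorem apply_prod_int_eq {f : H × ℤ → C} (hf : mulDiff ((0, 1) : H × ℤ) f = 1) (h : H) (x : ℤ) :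
    f (h, x) = f (h, 0) := by
  have key : ∀ y : ℤ, f (h, y + 1) = f (h, y) := fun y => by
    have := congrFun hf (h, y)
    simpa [mulDiff, mul_inv_eq_one, add_comm] using this
  induction x using Int.induction_on with
  | zero => rfl
  | succ i ih => rw [key, ih]
  | pred i ih => rw [← ih, ← key, sub_add_cancel]

/-- A difference in direction `(h, x)`, restricted to `H × {0}`, splits into a vertical difference
and a difference of the restriction. Differences commute, so its own vertical difference drops in
degree too, and induction applies. -/
theorem of_prod_int {m : ℕ} {f : H × ℤ → C} (he : IsPolyMap m (mulDiff ((0, 1) : H × ℤ) f))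
    (hH : IsPolyMap (m + 1) fun h : H => f (h, 0)) : IsPolyMap (m + 1) f := by
  induction m generalizing f with
  | zero =>
    rintro ⟨h, x⟩
    funext ⟨h', x'⟩
    have h1 := congrFun (hH h) h'
    simp only [mulDiff, Prod.mk_add_mk, Pi.one_apply] at h1 ⊢
    rw [apply_prod_int_eq he, apply_prod_int_eq he h' x', h1]
  | succ m ih =>
    rintro ⟨h, x⟩
    refine ih ?_ ?_
    · rw [mulDiff_comm]
      exact he _
    · have h0 : x • ((0, 1) : H × ℤ) ∈ diffSubgroup (m + 1) f := zsmul_mem he x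
      have h1 : IsPolyMap (m + 1) (mulDiff ((0, x) : H × ℤ) f) := by
        simpa [diffSubgroup] using h0
      have h2 := (h1.comp_add_hom (AddMonoidHom.inl H ℤ) (h, 0)).mul (hH h)
      convert h2 using 1
      funext h'
      simp [mulDiff]

/-- Discrete integration over `ℤ`. The step is a permutation of `ℤ × C`, so its integer powers run
the recursion in both directions. -/
theorem exists_int_recursion (a : ℤ → C) (c : C) :
    ∃ b : ℤ → C, b 0 = c ∧ ∀ x, b (x + 1) = a x * b x := by
  let T : Equiv.Perm (ℤ × C) :=
    { toFun := fun p => (p.1 + 1, a p.1 * p.2)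
      invFun := fun p => (p.1 - 1, (a (p.1 - 1))⁻¹ * p.2)
      left_inv := fun p => by simp
      right_inv := fun p => by simp }
  have h1 : ∀ x : ℤ, ((T ^ x) (0, c)).1 = x := fun x => by
    induction x using Int.induction_on with
    | zero => rfl
    | succ i ih => rw [add_comm, zpow_add, zpow_one, Equiv.Perm.mul_apply, add_comm]
                   change ((T ^ (i : ℤ)) (0, c)).1 + 1 = _
                   rw [ih]
    | pred i ih => rw [sub_eq_neg_add, zpow_add, zpow_neg_one, Equiv.Perm.mul_apply, add_comm]
                   change ((T ^ (-i : ℤ)) (0, c)).1 - 1 = _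
                   rw [ih, sub_eq_add_neg]
  refine ⟨fun x => ((T ^ x) (0, c)).2, rfl, fun x => ?_⟩
  simp only
  rw [add_comm, zpow_add, zpow_one, Equiv.Perm.mul_apply]
  change a ((T ^ x) (0, c)).1 * _ = _
  rw [h1]

/-! ### Roots of polynomial maps on torsion-free groups. -/

/-- All polynomial maps on `G` with values in `C` have roots that are polynomial maps of the same
degree. -/
def HasRoots (G C : Type*) [AddCommGroup G] [CommGroup C] : Prop :=
  ∀ (n : ℕ), n ≠ 0 → ∀ (m : ℕ) (f : G → C), IsPolyMap m f → ∃ q, IsPolyMap m q ∧ q ^ n = f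

/-- Take a root `r` of the vertical difference of `f` and a root `s` of `f` on `H × {0}`, and
integrate `r` vertically starting from `s`. The `n`-th power of the result has the vertical
difference and the initial values of `f`, so it is `f`. -/
theorem HasRoots.prod_int (h : HasRoots H C) : HasRoots (H × ℤ) C := by
  intro n hn m
  induction m with
  | zero => exact fun f hf => ⟨1, .one 0, by rw [one_pow]; exact hf.symm⟩
  | succ m ih =>
    intro f hf
    obtain ⟨r, hr, hrn⟩ := ih _ (hf (0, 1))
    obtain ⟨s, hs, hsn⟩ := h n hn (m + 1) _ (hf.comp_hom (AddMonoidHom.inl H ℤ))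
    choose b hb0 hb using fun y : H => exists_int_recursion (fun x => r (y, x)) (s y)
    refine ⟨fun p => b p.1 p.2, of_prod_int ?_ ?_, ?_⟩
    · convert hr using 1
      funext ⟨y, x⟩
      simp [mulDiff, add_comm (1 : ℤ) x, hb]
    · simpa only [hb0] using hs
    · rw [← div_eq_one]
      funext ⟨y, x⟩
      refine (apply_prod_int_eq (f := (fun p => b p.1 p.2) ^ n / f) ?_ y x).trans ?_
      · rw [div_eq_mul_inv, mulDiff_mul, mulDiff_inv, mulDiff_pow, mul_inv_eq_one, ← hrn]
        congr 1
        funext ⟨y, x⟩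
        simp [mulDiff, add_comm (1 : ℤ) x, hb]
      · have := congrFun hsn y
        simp only [Pi.pow_apply, AddMonoidHom.inl_apply] at this
        simp [hb0, this]

theorem HasRoots.of_equiv (h : HasRoots H C) (e : G ≃+ H) : HasRoots G C := by
  intro n hn m f hf
  obtain ⟨q, hq, hqn⟩ := h n hn m _ (hf.comp_hom e.symm.toAddMonoidHom)
  refine ⟨_, hq.comp_hom e.toAddMonoidHom, ?_⟩
  funext x
  have := congrFun hqn (e x)
  simpa using this

theorem HasRoots.of_subsingleton [Subsingleton G] (hC : ∀ n : ℕ, n ≠ 0 → ∀ c : C, ∃ d, d ^ n = c) :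
    HasRoots G C := by
  intro n hn m f hf
  obtain _ | m := m
  · exact ⟨1, .one 0, by rw [one_pow]; exact hf.symm⟩
  · obtain ⟨d, hd⟩ := hC n hn (f 0)
    refine ⟨fun _ => d, fun g => ?_, ?_⟩
    · rw [Subsingleton.elim g 0, mulDiff_zero]
      exact .one m
    · funext x
      rw [Subsingleton.elim x 0]
      exact hd

theorem HasRoots.fin_int (hC : ∀ n : ℕ, n ≠ 0 → ∀ c : C, ∃ d, d ^ n = c) (d : ℕ) :
    HasRoots (Fin d → ℤ) C := by
  induction d with
  | zero => exact .of_subsingleton hC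
  | succ d ih =>
    let e : (Fin (d + 1) → ℤ) ≃+ (Fin d → ℤ) × ℤ :=
      { toFun := fun f => (Fin.tail f, f 0)
        invFun := fun p => Fin.cons p.2 p.1
        left_inv := fun f => by simp
        right_inv := fun p => by simp
        map_add' := fun f g => rfl }
    exact ih.prod_int.of_equiv e

theorem HasRoots.of_fg [Module.Finite ℤ G] [IsAddTorsionFree G]
    (hC : ∀ n : ℕ, n ≠ 0 → ∀ c : C, ∃ d, d ^ n = c) : HasRoots G C :=
  (HasRoots.fin_int hC _).of_equiv (Module.finBasis ℤ G).equivFun.toAddEquiv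

/-- Each instance of the vanishing of differences involves only finitely many group elements. -/
theorem of_closure_finset {m : ℕ} {f : G → C}
    (h : ∀ S : Finset G, IsPolyMap m fun x : AddSubgroup.closure (S : Set G) => f x) :
    IsPolyMap m f := by
  classical
  induction m generalizing f with
  | zero =>
    funext x
    exact congrFun (h {x}) ⟨x, AddSubgroup.subset_closure (by simp)⟩
  | succ m ih =>
    intro g
    refine ih fun S => ?_
    have hle : AddSubgroup.closure (S : Set G) ≤ AddSubgroup.closure ((insert g S : Finset G) : Set G) :=
      AddSubgroup.closure_mono (by simp)
    have h1 := h (insert g S) ⟨g, AddSubgroup.subset_closure (by simp)⟩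
    exact h1.comp_hom (AddSubgroup.inclusion hle)

theorem isClosed_setOf [TopologicalSpace C] [IsTopologicalGroup C] [T2Space C] (m : ℕ) :
    IsClosed {f : G → C | IsPolyMap m f} := by
  induction m with
  | zero => exact isClosed_singleton
  | succ m ih =>
    have : {f : G → C | IsPolyMap (m + 1) f} = ⋂ g, mulDiff g ⁻¹' {f | IsPolyMap m f} := by
      ext f; simp [IsPolyMap]
    rw [this]
    refine isClosed_iInter fun g => ih.preimage ?_
    unfold mulDiff
    fun_prop

/-- On a torsion-free abelian group, polynomial maps to a compact divisible group have roots. -/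
theorem hasRoots [IsAddTorsionFree G] [TopologicalSpace C] [IsTopologicalGroup C] [T2Space C]
    [CompactSpace C] (hC : ∀ n : ℕ, n ≠ 0 → ∀ c : C, ∃ d, d ^ n = c) : HasRoots G C := by
  classical
  intro n hn m f hf
  -- All roots of `f` that are polynomial on the subgroup generated by `S`: a directed family of
  -- nonempty closed sets in a compact product.
  let K : Finset G → Set (G → C) := fun S =>
    {q | q ^ n = f} ∩ (fun (q : G → C) (x : AddSubgroup.closure (S : Set G)) => q x) ⁻¹'
      {q | IsPolyMap m q}
  have hcl : ∀ S, IsClosed (K S) := fun S =>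
    (isClosed_eq (by fun_prop) continuous_const).inter
      ((isClosed_setOf m).preimage (by fun_prop))
  have hanti : ∀ S T : Finset G, S ⊆ T → K T ⊆ K S := by
    rintro S T hST q ⟨hq, hqm⟩
    have hle : AddSubgroup.closure (S : Set G) ≤ AddSubgroup.closure (T : Set G) :=
      AddSubgroup.closure_mono (by simpa using hST)
    exact ⟨hq, IsPolyMap.comp_hom hqm (AddSubgroup.inclusion hle)⟩
  have hne : ∀ S, (K S).Nonempty := by
    intro S
    have : Module.Finite ℤ (AddSubgroup.closure (S : Set G)) :=
      Module.Finite.iff_addGroup_fg.2 ((AddGroup.fg_iff_addSubgroup_fg _).2 ⟨S, rfl⟩)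
    obtain ⟨q, hq, hqn⟩ := HasRoots.of_fg (G := AddSubgroup.closure (S : Set G)) hC n hn m _
      (hf.comp_hom (AddSubgroup.closure (S : Set G)).subtype)
    choose d hd using fun x => hC n hn (f x)
    -- Outside the subgroup any pointwise root will do, as `K S` imposes no polynomial condition
    -- there.
    refine ⟨fun x => if hx : x ∈ AddSubgroup.closure (S : Set G) then q ⟨x, hx⟩ else d x, ?_, ?_⟩
    · funext x
      by_cases hx : x ∈ AddSubgroup.closure (S : Set G)
      · have := congrFun hqn ⟨x, hx⟩
        simpa [hx] using this
      · simp [hx, hd]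
    · simpa using hq
  obtain ⟨q, hq⟩ := IsCompact.nonempty_iInter_of_directed_nonempty_isCompact_isClosed K
    (fun S T => ⟨S ∪ T, hanti _ _ Finset.subset_union_left, hanti _ _ Finset.subset_union_right⟩)
    hne (fun S => (hcl S).isCompact) hcl
  rw [Set.mem_iInter] at hq
  exact ⟨q, of_closure_finset fun S => (hq S).2, (hq ∅).1⟩

end IsPolyMap

/-! ### Iterated differences and symbols. -/

/-- The iterated difference of `f : G → C`, in the same order as `GSystem.iterDeriv`. -/
def iterDiff {G C : Type*} [AddCommGroup G] [CommGroup C] :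
    (k : ℕ) → (Fin k → G) → (G → C) → G → C
  | 0, _, f => f
  | k + 1, g, f => mulDiff (g 0) (iterDiff k (Fin.tail g) f)

namespace IsPolyMap

variable {G C : Type*} [AddCommGroup G] [CommGroup C]

/-- `iterDiff` peels off the outermost difference and `IsPolyMap` the innermost; commutation of
differences reconciles the two. -/
theorem iterDiff_succ' (k : ℕ) (g : Fin (k + 1) → G) (f : G → C) :
    iterDiff (k + 1) g f = iterDiff k (Fin.tail g) (mulDiff (g 0) f) := by
  induction k with
  | zero => rfl
  | succ k ih =>
    change mulDiff (g 0) (mulDiff (Fin.tail g 0) (iterDiff k (Fin.tail (Fin.tail g)) f)) = _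
    rw [mulDiff_comm]
    have h := ih (Fin.cons (g 0) (Fin.tail (Fin.tail g)))
    simp only [iterDiff, Fin.cons_zero, Fin.tail_cons] at h ⊢
    rw [h]

theorem iterDiff_mul (k : ℕ) (g : Fin k → G) (f f' : G → C) :
    iterDiff k g (f * f') = iterDiff k g f * iterDiff k g f' := by
  induction k with
  | zero => rfl
  | succ k ih => simp only [iterDiff, ih, mulDiff_mul]

theorem iterDiff_pow (k : ℕ) (g : Fin k → G) (f : G → C) (n : ℕ) :
    iterDiff k g (f ^ n) = iterDiff k g f ^ n := by
  induction k with
  | zero => rfl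
  | succ k ih => simp only [iterDiff, ih, mulDiff_pow]

theorem iff_iterDiff {m : ℕ} {f : G → C} :
    IsPolyMap m f ↔ ∀ g : Fin m → G, iterDiff m g f = 1 := by
  induction m generalizing f with
  | zero => exact ⟨fun h _ => h, fun h => h 0⟩
  | succ m ih =>
    refine ⟨fun h g => ?_, fun h a => ih.2 fun g => ?_⟩
    · rw [iterDiff_succ']
      exact ih.1 (h (g 0)) _
    · have := h (Fin.cons a g)
      rwa [iterDiff_succ', Fin.cons_zero, Fin.tail_cons] at this

theorem of_iterDiff_eq {m : ℕ} {f : G → C} {l : (Fin m → G) → C}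
    (h : ∀ g x, iterDiff m g f x = l g) : IsPolyMap (m + 1) f := by
  refine iff_iterDiff.2 fun g => ?_
  funext x
  simp [iterDiff, mulDiff, h]

/-- The symbol of a polynomial map is a homomorphism in its first variable. -/
theorem symbol_nsmul {m : ℕ} {f : G → C} {l : (Fin (m + 1) → G) → C}
    (h : ∀ g x, iterDiff (m + 1) g f x = l g) (g : Fin (m + 1) → G) (n : ℕ) :
    l (Fin.cons (n • g 0) (Fin.tail g)) = l g ^ n := by
  have key : ∀ a x, iterDiff m (Fin.tail g) f (a + x) =
      l (Fin.cons a (Fin.tail g)) * iterDiff m (Fin.tail g) f x := fun a x => by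
    have := h (Fin.cons a (Fin.tail g)) x
    rw [← this]
    simp [iterDiff, mulDiff]
  have h1 : iterDiff m (Fin.tail g) f (n • g 0) = l g ^ n * iterDiff m (Fin.tail g) f 0 := by
    induction n with
    | zero => simp
    | succ n ih =>
      rw [succ_nsmul', key, ih, pow_succ', mul_assoc, Fin.cons_self_tail]
  have h2 := key (n • g 0) 0
  rw [add_zero, h1] at h2
  exact (mul_right_cancel h2).symm

end IsPolyMap

/-! ### Metric facts about the circle. -/

namespace Circle

theorem dist_eq_norm_coe (z w : Circle) : dist z w = ‖(z : ℂ) - w‖ :=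
  Complex.dist_eq (z : ℂ) (w : ℂ)

theorem continuous_val : Continuous fun z : Circle => (z : ℂ) :=
  continuous_subtype_val

theorem edist_eq_enorm_coe (z w : Circle) : edist z w = ‖(z : ℂ) - w‖ₑ := by
  rw [edist_dist, dist_eq_norm_coe, ofReal_norm]

theorem edist_mul_inv_one (z w : Circle) : edist (z * w⁻¹) 1 = edist z w := by
  rw [edist_dist, edist_dist, dist_eq_norm_coe, dist_eq_norm_coe]
  have h : (z : ℂ) - w = ((z * w⁻¹ : Circle) - (1 : Circle) : ℂ) * w := by
    rw [sub_mul, ← Circle.coe_mul, inv_mul_cancel_right, Circle.coe_one, one_mul]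
  rw [h, norm_mul, Circle.norm_coe, mul_one]

theorem exists_pow_eq (n : ℕ) (hn : n ≠ 0) (z : Circle) : ∃ w : Circle, w ^ n = z := by
  obtain ⟨t, rfl⟩ := Circle.exp_surjective z
  refine ⟨Circle.exp (t / n), ?_⟩
  rw [← Circle.exp_natCast_mul, mul_div_cancel₀ _ (Nat.cast_ne_zero.2 hn)]

/-- The circle has no small subgroups: within distance `1 / 2` of `1`, the identity `w² - 1 = (w -
1)(w + 1)` shows that squaring expands the distance to `1` by at least `3 / 2`. -/
theorem eq_one_of_forall_dist_pow_le (z : Circle) (h : ∀ n : ℕ, dist (z ^ n) 1 ≤ 1 / 2) :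
    z = 1 := by
  have hstep : ∀ n : ℕ, (3 / 2 : ℝ) ^ n * dist z 1 ≤ dist (z ^ 2 ^ n) 1 := by
    intro n
    induction n with
    | zero => simp
    | succ n ih =>
      have hd : ∀ w : Circle, dist w 1 = ‖(w : ℂ) - 1‖ := fun w => by
        rw [dist_eq_norm_coe, Circle.coe_one]
      have h1 := h (2 ^ n)
      set w := z ^ 2 ^ n
      have hw : z ^ 2 ^ (n + 1) = w ^ 2 := by rw [pow_succ, pow_mul]
      have h2 : dist (w ^ 2) 1 = dist w 1 * ‖(w : ℂ) + 1‖ := by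
        rw [hd, hd, ← norm_mul]
        congr 1
        push_cast
        ring
      have h3 : 3 / 2 ≤ ‖(w : ℂ) + 1‖ := by
        have h4 := norm_sub_norm_le (2 : ℂ) (1 - w)
        have h5 : (2 : ℂ) - (1 - w) = w + 1 := by ring
        rw [h5, norm_sub_rev, ← hd] at h4
        norm_num at h4
        linarith
      rw [hw, h2, pow_succ]
      nlinarith [dist_nonneg (x := w) (y := 1), dist_nonneg (x := z) (y := 1)]
  by_contra hz
  have hpos : 0 < dist z 1 := dist_pos.2 hz
  obtain ⟨n, hn⟩ := pow_unbounded_of_one_lt (1 / dist z 1) (by norm_num : (1 : ℝ) < 3 / 2)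
  rw [div_lt_iff₀ hpos] at hn
  linarith [hstep n, h (2 ^ n)]

end Circle

/-! ### Symbols along orbits and countability of the spectra. -/

namespace GSystem

variable {G : Type v} [AddCommGroup G] (X : GSystem.{u} G)

theorem iterDeriv_vadd (k : ℕ) (g : Fin k → G) (P : X.carrier → Circle) (a : G) (x : X.carrier) :
    X.iterDeriv k g P (a +ᵥ x) = iterDiff k g (fun b => P (b +ᵥ x)) a := by
  induction k generalizing a with
  | zero => rfl
  | succ k ih => simp only [iterDeriv, mulDeriv, iterDiff, mulDiff, ← ih, add_vadd]

theorem iterDeriv_eq_iterDiff (k : ℕ) (g : Fin k → G) (P : X.carrier → Circle) (x : X.carrier) :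
    X.iterDeriv k g P x = iterDiff k g (fun b => P (b +ᵥ x)) 0 := by
  rw [← iterDeriv_vadd, zero_vadd]

variable {X}

theorem ae_vadd {p : X.carrier → Prop} (h : ∀ᵐ x ∂X.μ, p x) (g : G) : ∀ᵐ x ∂X.μ, p (g +ᵥ x) := by
  rw [← X.map_vadd g] at h
  exact ae_of_ae_map (X.aemeasurable_vadd g) h

/-- Restricting a phase polynomial to a generic orbit gives a polynomial map on `G` with the same
symbol. -/
theorem exists_iterDiff_eq [Countable G] {i : ℕ} {l : (Fin i → G) → Circle} (hl : l ∈ X.Spec i) :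
    ∃ p : G → Circle, ∀ g x, iterDiff i g p x = l g := by
  obtain ⟨P, -, hP⟩ := hl
  -- Countability of `G` gives one null set serving all derivatives and the whole orbit.
  have h : ∀ᵐ x ∂X.μ, ∀ (g : Fin i → G) (a : G), X.iterDeriv i g P (a +ᵥ x) = l g :=
    ae_all_iff.2 fun g => ae_all_iff.2 fun a => ae_vadd (hP g) a
  obtain ⟨x, hx⟩ := h.exists
  exact ⟨fun b => P (b +ᵥ x), fun g a => by rw [← iterDeriv_vadd, hx]⟩

/-- Multiplying the first argument by `n` raises the value of the symbol to the power `n`, so all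
powers of each value stay near `1`. Positive degree provides that first argument. -/
theorem eq_one_of_forall_dist_le [Countable G] {i : ℕ} {l : (Fin (i + 1) → G) → Circle}
    (hl : l ∈ X.Spec (i + 1)) (h : ∀ g, dist (l g) 1 ≤ 1 / 2) : l = 1 := by
  obtain ⟨p, hp⟩ := exists_iterDiff_eq hl
  funext g
  refine Circle.eq_one_of_forall_dist_pow_le _ fun n => ?_
  rw [← IsPolyMap.symbol_nsmul hp g n]
  exact h _

theorem aestronglyMeasurable_vadd {R : X.carrier → Circle} (hR : AEStronglyMeasurable R X.μ)
    (g : G) : AEStronglyMeasurable (fun x => R (g +ᵥ x)) X.μ := by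
  rw [← X.map_vadd g] at hR
  exact hR.comp_aemeasurable (X.aemeasurable_vadd g)

theorem lintegral_edist_mulDeriv_le {R : X.carrier → Circle} (hR : AEStronglyMeasurable R X.μ)
    (g : G) : ∫⁻ x, edist (X.mulDeriv g R x) 1 ∂X.μ ≤ 2 * ∫⁻ x, edist (R x) 1 ∂X.μ := by
  have h1 : AEMeasurable (fun x => edist (R x) 1) X.μ :=
    hR.edist aestronglyMeasurable_const
  have h2 : ∫⁻ x, edist (R (g +ᵥ x)) 1 ∂X.μ = ∫⁻ x, edist (R x) 1 ∂X.μ := by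
    conv_rhs => rw [← X.map_vadd g]
    rw [lintegral_map' (by rwa [X.map_vadd g]) (X.aemeasurable_vadd g)]
  calc ∫⁻ x, edist (X.mulDeriv g R x) 1 ∂X.μ
      ≤ ∫⁻ x, (edist (R (g +ᵥ x)) 1 + edist (R x) 1) ∂X.μ := by
        refine lintegral_mono fun x => ?_
        rw [mulDeriv, Circle.edist_mul_inv_one]
        exact edist_triangle_right _ _ _
    _ = 2 * ∫⁻ x, edist (R x) 1 ∂X.μ := by
        rw [lintegral_add_right' _ h1, h2, two_mul]

theorem aestronglyMeasurable_iterDeriv {R : X.carrier → Circle} (hR : AEStronglyMeasurable R X.μ)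
    (k : ℕ) (g : Fin k → G) : AEStronglyMeasurable (X.iterDeriv k g R) X.μ := by
  induction k with
  | zero => exact hR
  | succ k ih => exact (aestronglyMeasurable_vadd (ih _) _).mul (ih _).inv

theorem lintegral_edist_iterDeriv_le {R : X.carrier → Circle} (hR : AEStronglyMeasurable R X.μ)
    (k : ℕ) (g : Fin k → G) :
    ∫⁻ x, edist (X.iterDeriv k g R x) 1 ∂X.μ ≤ 2 ^ k * ∫⁻ x, edist (R x) 1 ∂X.μ := by
  induction k with
  | zero => simp [iterDeriv]
  | succ k ih =>
    refine (lintegral_edist_mulDeriv_le (aestronglyMeasurable_iterDeriv hR k _) _).trans ?_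
    rw [pow_succ', mul_assoc]
    gcongr
    exact ih _

/-- Phase polynomials of the same positive degree with different symbols are far apart. -/
theorem le_lintegral_edist [Countable G] {i : ℕ} {l l' : (Fin (i + 1) → G) → Circle}
    {P P' : X.carrier → Circle} (hP : X.IsPhasePoly (i + 2) P)
    (hl : ∀ g, X.iterDeriv (i + 1) g P =ᵐ[X.μ] fun _ => l g) (hP' : X.IsPhasePoly (i + 2) P')
    (hl' : ∀ g, X.iterDeriv (i + 1) g P' =ᵐ[X.μ] fun _ => l' g) (hne : l ≠ l') :
    ENNReal.ofReal ((1 / 2) ^ (i + 2)) ≤ ∫⁻ x, edist (P x) (P' x) ∂X.μ := by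
  by_contra! hlt
  have hmem : l * l'⁻¹ ∈ X.Spec (i + 1) :=
    mul_mem ⟨P, hP, hl⟩ (inv_mem ⟨P', hP', hl'⟩)
  refine hne (mul_inv_eq_one.1 (eq_one_of_forall_dist_le hmem fun g => ?_))
  have hR := lintegral_edist_iterDeriv_le (hP.1.mul hP'.1.inv) (i + 1) g
  have hsymb : ∀ᵐ x ∂X.μ, X.iterDeriv (i + 1) g (P * P'⁻¹) x = (l * l'⁻¹) g := by
    filter_upwards [hl g, hl' g] with x h1 h2
    have h3 := congrFun (X.iterDeriv_mul (i + 1) g P P'⁻¹) x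
    have h4 := congrFun (X.iterDeriv_inv (i + 1) g P') x
    rw [Pi.mul_apply, Pi.inv_apply, ← h1, ← h2, ← h4]
    exact h3
  have h1 : ∫⁻ x, edist (X.iterDeriv (i + 1) g (P * P'⁻¹) x) 1 ∂X.μ = edist ((l * l'⁻¹) g) 1 := by
    rw [lintegral_congr_ae (hsymb.mono fun x hx => by rw [hx] :
      _ =ᵐ[X.μ] fun _ => edist ((l * l'⁻¹) g) 1)]
    simp
  have h2 : ∫⁻ x, edist ((P * P'⁻¹) x) 1 ∂X.μ = ∫⁻ x, edist (P x) (P' x) ∂X.μ :=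
    lintegral_congr fun x => Circle.edist_mul_inv_one _ _
  rw [h1, h2] at hR
  have h3 : edist ((l * l'⁻¹) g) 1 ≤ ENNReal.ofReal (1 / 2) := by
    -- Each of the `i + 1` derivatives at most doubles the `L¹` distance to `1`, so `(1 / 2) ^ (i +
    -- 2)` becomes `1 / 2`.
    refine hR.trans ((mul_le_mul_right hlt.le _).trans (le_of_eq ?_))
    rw [show (2 : ENNReal) = ENNReal.ofReal 2 by simp, ← ENNReal.ofReal_pow (by norm_num),
      ← ENNReal.ofReal_mul (by positivity)]
    congr 1
    rw [pow_succ _ (i + 1), ← mul_assoc, ← mul_pow]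
    norm_num
  rwa [edist_dist, ENNReal.ofReal_le_ofReal_iff (by norm_num)] at h3

/-- The spectra of positive degree are countable. -/
theorem countable_spec [Countable G] (i : ℕ) : Countable (X.Spec (i + 1)) := by
  choose P hP hl using fun l : X.Spec (i + 1) => l.2
  have hLp : ∀ l, MemLp (fun x => (P l x : ℂ)) 1 X.μ := fun l =>
    MemLp.of_bound (Circle.continuous_val.comp_aestronglyMeasurable (hP l).1) 1
      (Eventually.of_forall fun x => (Circle.norm_coe _).le)
  have : Fact ((1 : ENNReal) ≠ ⊤) := ⟨ENNReal.one_ne_top⟩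
  -- Balls of half the separation radius around chosen phase polynomials are disjoint and open in
  -- the separable space `L¹`.
  refine Pairwise.countable_of_isOpen_disjoint
    (s := fun l => Metric.eball ((hLp l).toLp _) (ENNReal.ofReal ((1 / 2) ^ (i + 2)) / 2))
    (fun l l' hne => ?_) (fun l => Metric.isOpen_eball)
    (fun l => ⟨_, Metric.mem_eball_self (ENNReal.div_pos (by simp) (by simp))⟩)
  refine Metric.eball_disjoint ?_
  rw [ENNReal.add_halves, Lp.edist_toLp_toLp, eLpNorm_one_eq_lintegral_enorm]
  simp only [Pi.sub_apply, ← Circle.edist_eq_enorm_coe]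
  exact le_lintegral_edist (hP l) (hl l) (hP l') (hl l') fun h => hne (Subtype.ext h)

end GSystem

/-! ### Ergodic joinings. -/

namespace GSystem

open Measure Topology

variable {G : Type v} [AddCommGroup G]

/-- An invariant measure dominated by an ergodic one is a multiple of it. -/
theorem Ergodic.measure_eq_of_absolutelyContinuous {X : GSystem.{u} G} (hX : X.Ergodic)
    (ρ : Measure X.carrier) [IsProbabilityMeasure ρ] (hρ : ρ ≪ X.μ)
    (hinv : ∀ g : G, ρ.map (fun x => g +ᵥ x) = ρ) : ρ = X.μ := by
  have hE : ErgodicVAdd G X.carrier X.μ := hX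
  -- Invariance of both measures makes the density invariant; ergodicity then makes it constant.
  have hh : ∀ g : G, ρ.rnDeriv X.μ ∘ (fun x => g +ᵥ x) =ᵐ[X.μ] ρ.rnDeriv X.μ := by
    intro g
    have hT := X.aemeasurable_vadd g
    have h1 : MeasurePreserving (hT.mk _) X.μ X.μ :=
      ⟨hT.measurable_mk, by rw [← Measure.map_congr hT.ae_eq_mk, X.map_vadd g]⟩
    have h2 : MeasurePreserving (hT.mk _) ρ ρ :=
      ⟨hT.measurable_mk, by rw [← Measure.map_congr (hρ.ae_le hT.ae_eq_mk), hinv g]⟩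
    refine EventuallyEq.trans ?_ (h2.rnDeriv_comp_aeEq h1)
    filter_upwards [hT.ae_eq_mk] with x hx
    simp [Function.comp_apply, ← hx]
  obtain ⟨c, hc⟩ : ∃ c, ρ.rnDeriv X.μ =ᵐ[X.μ] Function.const _ c := by
    refine exists_eventuallyEq_const_of_forall_separating MeasurableSet fun U hU => ?_
    have h3 : EventuallyConst (ρ.rnDeriv X.μ ⁻¹' U) (ae X.μ) := by
      refine hE.aeconst_of_forall_preimage_vadd_ae_eq (measurable_rnDeriv ρ X.μ hU) fun g => ?_
      exact (hh g).preimage U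
    exact eventuallyConst_set.1 h3
  have h4 : ρ = c • X.μ := by
    rw [← withDensity_rnDeriv_eq ρ X.μ hρ, withDensity_congr_ae hc]
    exact withDensity_const c
  have h5 : c = 1 := by
    have := congrArg (fun m : Measure X.carrier => m Set.univ) h4
    simpa using this.symm
  rw [h4, h5, one_smul]

section Joining

variable (X : GSystem.{u} G) (W : Type u) [MetricSpace W] [CompactSpace W] [MeasurableSpace W]
  [BorelSpace W] [AddAction G W]

/-- The invariant probability measures on `X × W` with first marginal `X.μ`. -/
def joinings : Set (ProbabilityMeasure (X.carrier × W)) :=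
  {ν | (ν : Measure (X.carrier × W)).map Prod.fst = X.μ ∧
    ∀ g : G, (ν : Measure (X.carrier × W)).map (fun p => (g +ᵥ p.1, g +ᵥ p.2)) = ν}

variable {X W}

omit [CompactSpace W] in
theorem aemeasurable_vadd_prod (hW : ∀ g : G, Continuous fun w : W => g +ᵥ w)
    {ν : Measure (X.carrier × W)} (hν : ν.map Prod.fst ≪ X.μ) (g : G) :
    AEMeasurable (fun p : X.carrier × W => (g +ᵥ p.1, g +ᵥ p.2)) ν :=
  (((X.aemeasurable_vadd g).mono_ac hν).comp_measurable measurable_fst).prodMk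
    ((hW g).measurable.comp measurable_snd).aemeasurable

theorem exists_mem_joinings (hW : ∀ g : G, Continuous fun w : W => g +ᵥ w) (m : Measure W)
    [IsProbabilityMeasure m] (hm : ∀ g : G, m.map (fun w => g +ᵥ w) = m) :
    (joinings X W).Nonempty := by
  refine ⟨⟨X.μ.prod m, inferInstance⟩, ?_, fun g => ?_⟩
  · simp
  · have hT := X.aemeasurable_vadd g
    have hfst : (X.μ.prod m).map Prod.fst = X.μ := by simp
    have h1 : (X.μ.prod m).map (fun p => (g +ᵥ p.1, g +ᵥ p.2)) =
        (X.μ.prod m).map (Prod.map (hT.mk _) (fun w => g +ᵥ w)) := by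
      refine Measure.map_congr ?_
      have h2 : ∀ᵐ p ∂(X.μ.prod m), g +ᵥ p.1 = hT.mk _ p.1 := by
        refine ae_of_ae_map (p := fun x => g +ᵥ x = hT.mk _ x) measurable_fst.aemeasurable ?_
        rw [hfst]
        exact hT.ae_eq_mk
      filter_upwards [h2] with p hp
      simp [Prod.map, hp]
    change (X.μ.prod m).map _ = X.μ.prod m
    rw [h1, ← map_prod_map _ _ hT.measurable_mk (hW g).measurable, hm,
      ← Measure.map_congr hT.ae_eq_mk, X.map_vadd]

omit [CompactSpace W] in
/-- An extreme joining with an ergodic system is ergodic. -/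
theorem aeconst_of_extreme (hX : X.Ergodic) (hW : ∀ g : G, Continuous fun w : W => g +ᵥ w)
    {ν : ProbabilityMeasure (X.carrier × W)} (hν : ν ∈ joinings X W)
    (hext : ∀ ν₁ ∈ joinings X W, ∀ ν₂ ∈ joinings X W, ∀ a b : ENNReal, a ≠ 0 → b ≠ 0 → a + b = 1 →
      (ν : Measure (X.carrier × W)) = a • ν₁ + b • ν₂ → ν₁ = ν)
    {s : Set (X.carrier × W)} (hs : MeasurableSet s)
    (hinv : ∀ g : G, (fun p : X.carrier × W => (g +ᵥ p.1, g +ᵥ p.2)) ⁻¹' s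
      =ᵐ[(ν : Measure (X.carrier × W))] s) :
    EventuallyConst s (ae (ν : Measure (X.carrier × W))) := by
  by_contra hcon
  -- Conditioning on an invariant set of positive measure yields a joining again: the first marginal
  -- is invariant and absolutely continuous, so it equals `X.μ` by ergodicity.
  have key : ∀ t : Set (X.carrier × W), MeasurableSet t →
      (ν : Measure (X.carrier × W)) t ≠ 0 →
      (∀ g : G, (fun p : X.carrier × W => (g +ᵥ p.1, g +ᵥ p.2)) ⁻¹' t
        =ᵐ[(ν : Measure (X.carrier × W))] t) →
      ∃ κ ∈ joinings X W, (κ : Measure (X.carrier × W)) =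
        ProbabilityTheory.cond (ν : Measure (X.carrier × W)) t := by
    intro t ht ht0 htinv
    have hac : ProbabilityTheory.cond (ν : Measure (X.carrier × W)) t ≪ ν :=
      ProbabilityTheory.cond_absolutelyContinuous
    have : IsProbabilityMeasure (ProbabilityTheory.cond (ν : Measure (X.carrier × W)) t) :=
      ProbabilityTheory.cond_isProbabilityMeasure ht0
    have hmac : (ProbabilityTheory.cond (ν : Measure (X.carrier × W)) t).map Prod.fst ≪ X.μ := by
      rw [← hν.1]
      exact hac.map measurable_fst
    have hg : ∀ g : G, (ProbabilityTheory.cond (ν : Measure (X.carrier × W)) t).map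
        (fun p => (g +ᵥ p.1, g +ᵥ p.2)) = ProbabilityTheory.cond (ν : Measure (X.carrier × W)) t := by
      intro g
      have hTν := aemeasurable_vadd_prod hW hν.1.absolutelyContinuous g
      ext B hB
      rw [map_apply_of_aemeasurable (aemeasurable_vadd_prod hW hmac g) hB,
        ProbabilityTheory.cond_apply ht, ProbabilityTheory.cond_apply ht]
      congr 1
      conv_rhs => rw [← hν.2 g, map_apply_of_aemeasurable hTν (ht.inter hB)]
      rw [Set.preimage_inter]
      exact measure_congr ((htinv g).symm.inter (ae_eq_refl _))
    refine ⟨⟨ProbabilityTheory.cond (ν : Measure (X.carrier × W)) t, this⟩, ⟨?_, hg⟩, rfl⟩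
    change (ProbabilityTheory.cond (ν : Measure (X.carrier × W)) t).map Prod.fst = X.μ
    have : IsProbabilityMeasure
        ((ProbabilityTheory.cond (ν : Measure (X.carrier × W)) t).map Prod.fst) :=
      isProbabilityMeasure_map measurable_fst.aemeasurable
    refine hX.measure_eq_of_absolutelyContinuous _ hmac fun g => ?_
    have h1 := congrArg (Measure.map Prod.fst) (hg g)
    rw [AEMeasurable.map_map_of_aemeasurable measurable_fst.aemeasurable
      (aemeasurable_vadd_prod hW hmac g)] at h1
    rw [AEMeasurable.map_map_of_aemeasurable ((X.aemeasurable_vadd g).mono_ac hmac)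
      measurable_fst.aemeasurable]
    exact h1
  have hs0 : (ν : Measure (X.carrier × W)) s ≠ 0 := fun h =>
    hcon (eventuallyConst_set.2 (Or.inr (measure_eq_zero_iff_ae_notMem.1 h)))
  have hsc0 : (ν : Measure (X.carrier × W)) sᶜ ≠ 0 := fun h =>
    hcon (eventuallyConst_set.2 (Or.inl (mem_ae_iff.2 h)))
  obtain ⟨ν₁, h1, h1c⟩ := key s hs hs0 hinv
  obtain ⟨ν₂, h2, h2c⟩ := key sᶜ hs.compl hsc0 fun g => (hinv g).compl
  have h := hext ν₁ h1 ν₂ h2 _ _ hs0 hsc0 (prob_add_prob_compl hs) (by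
    rw [h1c, h2c]
    ext B hB
    simp only [Measure.add_apply, Measure.smul_apply, smul_eq_mul,
      ProbabilityTheory.cond_apply hs, ProbabilityTheory.cond_apply hs.compl]
    rw [ENNReal.mul_inv_cancel_left hs0 (measure_ne_top _ _),
      ENNReal.mul_inv_cancel_left hsc0 (measure_ne_top _ _), Set.inter_comm, Set.inter_comm sᶜ,
      ← Set.sdiff_eq, measure_inter_add_sdiff _ hs])
  -- By extremality `ν` equals its conditioning on `s`, which gives `sᶜ` measure zero.
  apply hsc0
  rw [← h, h1c, ProbabilityTheory.cond_apply hs]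
  simp

open BoundedContinuousFunction

theorem integrable_vadd_fst (f : X.carrier →ᵇ ℝ) (g : G) :
    Integrable (fun x => f (g +ᵥ x)) X.μ :=
  Integrable.of_bound
    (f.continuous.measurable.comp_aemeasurable (X.aemeasurable_vadd g)).aestronglyMeasurable ‖f‖
    (Eventually.of_forall fun _ => f.norm_coe_le_norm _)

/-- Replacing the possibly discontinuous `f ∘ T_g` by a continuous `f'` costs an error that depends
on `ν` only through its fixed first marginal. -/
theorem abs_integral_sub_le (hW : ∀ g : G, Continuous fun w : W => g +ᵥ w)
    {ν : Measure (X.carrier × W)} [IsProbabilityMeasure ν] (hν : ν.map Prod.fst = X.μ)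
    (g : G) (f f' : X.carrier →ᵇ ℝ) (h : W →ᵇ ℝ) :
    |∫ p, f' p.1 * h (g +ᵥ p.2) ∂ν - ∫ p, f (g +ᵥ p.1) * h (g +ᵥ p.2) ∂ν| ≤
      (∫ x, ‖f (g +ᵥ x) - f' x‖ ∂X.μ) * ‖h‖ := by
  have hh : AEStronglyMeasurable (fun p : X.carrier × W => h (g +ᵥ p.2)) ν :=
    ((h.continuous.comp (hW g)).comp continuous_snd).aestronglyMeasurable
  have hb : ∀ᵐ p : X.carrier × W ∂ν, ‖h (g +ᵥ p.2)‖ ≤ ‖h‖ :=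
    Eventually.of_forall fun p => h.norm_coe_le_norm _
  have hfst : MeasurePreserving (Prod.fst : X.carrier × W → X.carrier) ν X.μ :=
    ⟨measurable_fst, hν⟩
  have h1 : Integrable (fun p : X.carrier × W => f' p.1) ν :=
    hfst.integrable_comp_of_integrable (f'.integrable X.μ)
  have h2 : Integrable (fun p : X.carrier × W => f (g +ᵥ p.1)) ν :=
    hfst.integrable_comp_of_integrable (integrable_vadd_fst f g)
  have h3 : ∫ x, ‖f (g +ᵥ x) - f' x‖ ∂X.μ =
      ∫ p : X.carrier × W, ‖f (g +ᵥ p.1) - f' p.1‖ ∂ν := by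
    rw [← hν, integral_map measurable_fst.aemeasurable]
    rw [hν]
    exact ((integrable_vadd_fst f g).sub (f'.integrable X.μ)).norm.aestronglyMeasurable
  rw [← integral_sub (h1.mul_bdd hh hb) (h2.mul_bdd hh hb), h3, ← integral_mul_const,
    ← Real.norm_eq_abs]
  refine norm_integral_le_of_norm_le ((h2.sub h1).norm.mul_const _)
    (Eventually.of_forall fun p => ?_)
  rw [← sub_mul, norm_mul, norm_sub_rev]
  exact mul_le_mul_of_nonneg_left (h.norm_coe_le_norm _) (norm_nonneg _)

/-- Invariance of a measure with first marginal `X.μ` can be tested on integrals of continuous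
functions, although the action on `X` is not continuous. -/
theorem map_vadd_prod_eq_iff (hW : ∀ g : G, Continuous fun w : W => g +ᵥ w)
    {ν : Measure (X.carrier × W)} [IsProbabilityMeasure ν] (hν : ν.map Prod.fst = X.μ) (g : G) :
    ν.map (fun p => (g +ᵥ p.1, g +ᵥ p.2)) = ν ↔
      ∀ (f f' : X.carrier →ᵇ ℝ) (h : W →ᵇ ℝ),
        |∫ p, f' p.1 * h (g +ᵥ p.2) ∂ν - ∫ p, f p.1 * h p.2 ∂ν| ≤
          (∫ x, ‖f (g +ᵥ x) - f' x‖ ∂X.μ) * ‖h‖ := by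
  have hT := aemeasurable_vadd_prod hW hν.absolutelyContinuous g
  have hmap : ∀ (f : X.carrier →ᵇ ℝ) (h : W →ᵇ ℝ),
      ∫ p, f p.1 * h p.2 ∂(ν.map fun p => (g +ᵥ p.1, g +ᵥ p.2)) =
        ∫ p, f (g +ᵥ p.1) * h (g +ᵥ p.2) ∂ν := fun f h =>
    integral_map hT (Continuous.aestronglyMeasurable (by fun_prop))
  constructor
  · intro hinv f f' h
    have h1 := hmap f h
    rw [hinv] at h1
    rw [h1]
    exact abs_integral_sub_le hW hν g f f' h
  · intro H
    have : IsProbabilityMeasure (ν.map fun p => (g +ᵥ p.1, g +ᵥ p.2)) := isProbabilityMeasure_map hT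
    refine ext_of_integral_mul_boundedContinuousFunction fun f h => ?_
    rw [hmap]
    refine eq_of_forall_dist_le fun ε hε => ?_
    -- The `+ 1` allows `h = 0`; each of the two errors below is at most `ε / 2`.
    have hpos : 0 < 2 * (‖h‖ + 1) := by positivity
    obtain ⟨f', hf', -⟩ := (integrable_vadd_fst f g).exists_boundedContinuous_integral_sub_le
      (div_pos hε hpos)
    have h1 := abs_integral_sub_le hW hν g f f' h
    have h2 := H f f' h
    have h3 : (∫ x, ‖f (g +ᵥ x) - f' x‖ ∂X.μ) * ‖h‖ ≤ ε / 2 := by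
      calc _ ≤ ε / (2 * (‖h‖ + 1)) * (‖h‖ + 1) := by gcongr; linarith
        _ = ε / 2 := by field_simp
    rw [abs_le] at h1 h2
    rw [Real.dist_eq, abs_le]
    constructor <;> linarith

/-- The criterion `map_vadd_prod_eq_iff` compares integrals of continuous functions with a bound
independent of `ν`, hence a weakly closed condition. -/
theorem isClosed_joinings (hW : ∀ g : G, Continuous fun w : W => g +ᵥ w) :
    IsClosed (joinings X W) := by
  have key : joinings X W =
      (⋂ f : X.carrier →ᵇ ℝ, {ν : ProbabilityMeasure (X.carrier × W) |
        ∫ p, f p.1 ∂(ν : Measure (X.carrier × W)) = ∫ x, f x ∂X.μ}) ∩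
      ⋂ (g : G) (f : X.carrier →ᵇ ℝ) (f' : X.carrier →ᵇ ℝ) (h : W →ᵇ ℝ),
        {ν : ProbabilityMeasure (X.carrier × W) | |∫ p, f' p.1 * h (g +ᵥ p.2) ∂(ν : Measure (X.carrier × W)) -
          ∫ p, f p.1 * h p.2 ∂(ν : Measure (X.carrier × W))| ≤
            (∫ x, ‖f (g +ᵥ x) - f' x‖ ∂X.μ) * ‖h‖} := by
    ext ν
    have hmarg : (ν : Measure (X.carrier × W)).map Prod.fst = X.μ ↔
        ∀ f : X.carrier →ᵇ ℝ, ∫ p, f p.1 ∂(ν : Measure (X.carrier × W)) = ∫ x, f x ∂X.μ := by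
      have hmap : ∀ f : X.carrier →ᵇ ℝ, ∫ p, f p.1 ∂(ν : Measure (X.carrier × W)) =
          ∫ x, f x ∂((ν : Measure (X.carrier × W)).map Prod.fst) := fun f =>
        (integral_map measurable_fst.aemeasurable f.continuous.aestronglyMeasurable).symm
      refine ⟨fun h f => by rw [hmap, h], fun h => ?_⟩
      exact ext_of_forall_integral_eq_of_IsFiniteMeasure fun f => by rw [← hmap, h]
    simp only [joinings, Set.mem_inter_iff, Set.mem_iInter, Set.mem_ofPred_eq, ← hmarg]
    exact and_congr_right fun h => forall_congr' fun g => map_vadd_prod_eq_iff hW h g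
  have hcont : ∀ F : X.carrier × W →ᵇ ℝ, Continuous fun ν : ProbabilityMeasure (X.carrier × W) =>
      ∫ p, F p ∂(ν : Measure (X.carrier × W)) :=
    fun F => ProbabilityMeasure.continuous_integral_boundedContinuousFunction F
  have hcont' : ∀ F : X.carrier × W → ℝ, Continuous F →
      Continuous fun ν : ProbabilityMeasure (X.carrier × W) =>
        ∫ p, F p ∂(ν : Measure (X.carrier × W)) :=
    fun F hF => hcont (BoundedContinuousFunction.mkOfCompact ⟨F, hF⟩)
  rw [key]
  refine (isClosed_iInter fun f => isClosed_eq (hcont' _ (by fun_prop)) continuous_const).inter ?_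
  refine isClosed_iInter fun g => isClosed_iInter fun f => isClosed_iInter fun f' =>
    isClosed_iInter fun h => isClosed_le ?_ continuous_const
  have hg := hW g
  exact ((hcont' _ (by fun_prop)).sub (hcont' _ (by fun_prop))).abs

/-- Integration against continuous functions embeds the measures in a locally convex space, where a
nonempty compact set has an extreme point. -/
theorem exists_extreme (hne : (joinings X W).Nonempty) (hcl : IsClosed (joinings X W)) :
    ∃ ν ∈ joinings X W, ∀ ν₁ ∈ joinings X W, ∀ ν₂ ∈ joinings X W, ∀ a b : ENNReal,
      a ≠ 0 → b ≠ 0 → a + b = 1 →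
      (ν : Measure (X.carrier × W)) = a • ν₁ + b • ν₂ → ν₁ = ν := by
  let Φ : ProbabilityMeasure (X.carrier × W) → (X.carrier × W →ᵇ ℝ) → ℝ :=
    fun ν f => ∫ p, f p ∂(ν : Measure (X.carrier × W))
  have hΦ : Continuous Φ := continuous_pi fun f =>
    ProbabilityMeasure.continuous_integral_boundedContinuousFunction f
  have hinj : Function.Injective Φ := fun ν₁ ν₂ h =>
    have := ν₁.2
    have := ν₂.2
    Subtype.ext (ext_of_forall_integral_eq_of_IsFiniteMeasure fun f => congrFun h f)
  obtain ⟨_, ⟨ν, hν, rfl⟩, hext⟩ := (hcl.isCompact.image hΦ).extremePoints_nonempty (hne.image Φ)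
  refine ⟨ν, hν, fun ν₁ h1 ν₂ h2 a b ha hb hab h => hinj ?_⟩
  have ha' : a ≠ ⊤ := fun h => by simp [h] at hab
  have hb' : b ≠ ⊤ := fun h => by simp [h] at hab
  refine hext (Set.mem_image_of_mem _ h1) (Set.mem_image_of_mem _ h2)
    ⟨a.toReal, b.toReal, ENNReal.toReal_pos ha ha', ENNReal.toReal_pos hb hb', ?_, ?_⟩
  · rw [← ENNReal.toReal_add ha' hb', hab, ENNReal.toReal_one]
  · funext f
    simp only [Φ, Pi.add_apply, Pi.smul_apply]
    rw [h, integral_add_measure ((f.integrable _).smul_measure ha')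
      ((f.integrable _).smul_measure hb'), integral_smul_measure, integral_smul_measure]

end Joining

theorem exists_ergodic_joining (X : GSystem.{u} G) (hX : X.Ergodic) (W : Type u) [MetricSpace W]
    [CompactSpace W] [MeasurableSpace W] [BorelSpace W] [AddAction G W]
    (hW : ∀ g : G, Continuous fun w : W => g +ᵥ w) (m : Measure W) [IsProbabilityMeasure m]
    (hm : ∀ g : G, m.map (fun w => g +ᵥ w) = m) :
    ∃ (Y : GSystem.{u} G) (_ : FactorMap Y X) (θ : Y.carrier → W), Y.Ergodic ∧ Measurable θ ∧
      ∀ (g : G) (y : Y.carrier), θ (g +ᵥ y) = g +ᵥ θ y := by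
  obtain ⟨ν, hν, hext⟩ := exists_extreme (exists_mem_joinings (X := X) hW m hm)
    (isClosed_joinings hW)
  have hne : Nonempty W := nonempty_of_isProbabilityMeasure m
  let Y : GSystem.{u} G :=
    { carrier := X.carrier × W
      μ := ν
      action := inferInstance
      aemeasurable_vadd := aemeasurable_vadd_prod hW hν.1.absolutelyContinuous
      map_vadd := hν.2 }
  refine ⟨Y, ⟨Prod.fst, measurable_fst.aemeasurable, hν.1, Prod.fst_surjective, fun _ _ => rfl⟩,
    Prod.snd, ?_, measurable_snd, fun _ _ => rfl⟩
  refine ErgodicVAdd.mk (toVAddInvariantMeasure := ⟨fun g s hs => ?_⟩) ?_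
  · rw [← map_apply_of_aemeasurable (Y.aemeasurable_vadd g) hs, Y.map_vadd]
  · exact fun hs hinv => aeconst_of_extreme hX hW hν hext hs hinv

end GSystem

/-! ### The compact system of polynomial sequences. -/

namespace GSystem

variable {G : Type v} [AddCommGroup G]

/-- The sequences of polynomial maps whose `t`-th term has degree `< d t`. -/
def polySubgroup (H : Type u) [AddCommGroup H] (d : ℕ → ℕ) : Subgroup (ℕ → H → Circle) where
  carrier := {r | ∀ t, IsPolyMap (d t) (r t)}
  one_mem' t := .one (d t)
  mul_mem' ha hb t := (ha t).mul (hb t)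
  inv_mem' ha t := (ha t).inv

theorem isClosed_polySubgroup (H : Type u) [AddCommGroup H] (d : ℕ → ℕ) :
    IsClosed (polySubgroup H d : Set (ℕ → H → Circle)) := by
  have : (polySubgroup H d : Set (ℕ → H → Circle)) =
      ⋂ t, (fun r : ℕ → H → Circle => r t) ⁻¹' {f | IsPolyMap (d t) f} := by
    ext r; simp [polySubgroup]
  rw [this]
  exact isClosed_iInter fun t => (IsPolyMap.isClosed_setOf (d t)).preimage (continuous_apply t)

/-- Translation of sequences of polynomial maps. -/
def polyShift {H : Type u} [AddCommGroup H] (d : ℕ → ℕ) (a : H) :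
    polySubgroup H d →* polySubgroup H d where
  toFun r := ⟨fun t h => r.1 t (a + h), fun t => (r.2 t).comp_add a⟩
  map_one' := rfl
  map_mul' _ _ := rfl

/-- Given polynomial maps `q t` of degree `< d t + 1` on a countable group `G ≃+ H`, the compact group of
sequences `r` of polynomial maps with `r t` of degree `< d t` carries the action for which the
products `r t * q t` are translated. -/
theorem exists_polynomial_system {H : Type u} [AddCommGroup H] [Countable H] (e : H ≃+ G)
    (d : ℕ → ℕ) (q : ℕ → G → Circle)
    (hq : ∀ t, IsPolyMap (d t + 1) (q t)) :
    ∃ (W : Type u) (_ : MetricSpace W) (_ : CompactSpace W) (_ : MeasurableSpace W)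
      (_ : BorelSpace W) (_ : AddAction G W) (m : Measure W) (_ : IsProbabilityMeasure m),
      (∀ g : G, Continuous fun w : W => g +ᵥ w) ∧ (∀ g : G, m.map (fun w => g +ᵥ w) = m) ∧
      ∃ Q : ℕ → W → Circle, (∀ t, Continuous (Q t)) ∧
        ∀ (t : ℕ) (w : W), ∃ r : G → Circle, IsPolyMap (d t) r ∧ ∀ a : G, Q t (a +ᵥ w) = r a * q t a := by
  let A := polySubgroup H d
  have hA : CompactSpace A := isCompact_iff_compactSpace.1 (isClosed_polySubgroup H d).isCompact
  have heval : ∀ (t : ℕ) (h : H), Continuous fun r : A => r.1 t h := fun t h =>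
    (continuous_apply_apply t h).comp continuous_subtype_val
  have hshift : ∀ a : H, Continuous (polyShift d a) := fun a =>
    Continuous.subtype_mk (continuous_pi fun t => continuous_pi fun h => heval t (a + h)) _
  have : SecondCountableTopology A := TopologicalSpace.Subtype.secondCountableTopology _
  have : TopologicalSpace.MetrizableSpace A := TopologicalSpace.metrizableSpace_of_t3_secondCountable A
  let : MetricSpace A := TopologicalSpace.metrizableSpaceMetric A
  let : MeasurableSpace A := _root_.borel A
  have : BorelSpace A := ⟨rfl⟩
  -- Differencing lowers the degree of `q t` by one, so these values lie in `A`. They form the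
  -- cocycle that corrects the translation of `r` to a translation of `r t * q t`.
  let c : G → A := fun a => ⟨fun t h => mulDiff a (q t) (e h),
    fun t => (hq t a).comp_hom e.toAddMonoidHom⟩
  let : AddAction G A :=
    { vadd := fun a r => polyShift d (e.symm a) r * c a
      zero_vadd := fun r => by
        refine Subtype.ext (funext fun t => funext fun h => ?_)
        change r.1 t (e.symm 0 + h) * mulDiff 0 (q t) (e h) = r.1 t h
        simp [mulDiff]
      add_vadd := fun a b r => by
        refine Subtype.ext (funext fun t => funext fun h => ?_)
        change r.1 t (e.symm (a + b) + h) * mulDiff (a + b) (q t) (e h) =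
          r.1 t (e.symm b + (e.symm a + h)) * mulDiff b (q t) (e (e.symm a + h)) *
            mulDiff a (q t) (e h)
        have h1 : e.symm (a + b) + h = e.symm b + (e.symm a + h) := by
          rw [map_add]; abel
        have h2 : e (e.symm a + h) = a + e h := by simp
        rw [h1, h2, mul_assoc]
        congr 1
        simp only [mulDiff]
        rw [mul_assoc, inv_mul_cancel_left, add_comm a b, add_assoc] }
  have hcont : ∀ g : G, Continuous fun w : A => g +ᵥ w := fun g =>
    (hshift (e.symm g)).mul continuous_const
  let m : Measure A := Measure.haarMeasure ⊤
  have hm : IsProbabilityMeasure m := ⟨Measure.haarMeasure_self⟩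
  refine ⟨A, inferInstance, hA, inferInstance, inferInstance, inferInstance, m, hm, hcont,
    fun g => ?_, fun t r => r.1 t 0 * q t 0, fun t => (heval t 0).mul continuous_const,
    fun t r => ?_⟩
  -- The action is affine: a surjective continuous endomorphism followed by a group translation,
  -- each preserving Haar measure.
  · have hsurj : Function.Surjective (polyShift (H := H) d (e.symm g)) := fun r =>
      ⟨polyShift d (-e.symm g) r, Subtype.ext (funext fun t => funext fun h =>
        congrArg (r.1 t) (neg_add_cancel_left (e.symm g) h))⟩
    have h1 : MeasurePreserving (polyShift (H := H) d (e.symm g)) m m :=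
      MonoidHom.measurePreserving (hshift _) hsurj rfl
    exact ((measurePreserving_mul_right m (c g)).comp h1).map_eq
  · refine ⟨fun a => r.1 t (e.symm a), (r.2 t).comp_hom e.symm.toAddMonoidHom, fun a => ?_⟩
    change r.1 t (e.symm a + 0) * mulDiff a (q t) (e 0) * q t 0 = _
    simp [mulDiff, mul_assoc]

/-- Every element of a spectrum of positive degree is the `n`-th power of the symbol of a polynomial
map on `G`. -/
theorem exists_root_symbol [Countable G] [IsAddTorsionFree G] {X : GSystem.{u} G} {i : ℕ}
    (l : X.Spec i) {n : ℕ} (hn : n ≠ 0) :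
    ∃ q : G → Circle, IsPolyMap (i + 1) q ∧ ∀ g, iterDiff i g q 0 ^ n = l.1 g := by
  obtain ⟨p, hp⟩ := exists_iterDiff_eq l.2
  obtain ⟨q, hq, hqp⟩ := IsPolyMap.hasRoots Circle.exists_pow_eq n hn (i + 1) p
    (IsPolyMap.of_iterDiff_eq hp)
  refine ⟨q, hq, fun g => ?_⟩
  rw [← hp g 0, ← hqp, IsPolyMap.iterDiff_pow, Pi.pow_apply]

/-- On every orbit `Q` is `q` times a map killed by `i` differences, so its `i`-th derivatives are
those of `q` at `0` times `1`, at every point. -/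
theorem symbol_mem_spec {Y : GSystem.{u} G} {i : ℕ} {q : G → Circle}
    {Q : Y.carrier → Circle} (hQ : AEStronglyMeasurable Q Y.μ)
    (h : ∀ y, ∃ r : G → Circle, IsPolyMap i r ∧ ∀ a : G, Q (a +ᵥ y) = r a * q a) :
    (fun g => iterDiff i g q 0) ∈ Y.Spec i := by
  have key : ∀ g y, Y.iterDeriv i g Q y = iterDiff i g q 0 := by
    intro g y
    obtain ⟨r, hr, hrq⟩ := h y
    have h1 : (fun b => Q (b +ᵥ y)) = r * q := funext hrq
    rw [iterDeriv_eq_iterDiff, h1, IsPolyMap.iterDiff_mul, IsPolyMap.iff_iterDiff.1 hr, one_mul]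
  refine ⟨Q, ⟨hQ, fun g => Eventually.of_forall fun y => ?_⟩,
    fun g => Eventually.of_forall (key g)⟩
  simp [iterDeriv, mulDeriv, key]

end GSystem

/-! ### Assembling the extension. -/

theorem mainTheorem8 (G : Type v) [AddCommGroup G] [Countable G] [IsAddTorsionFree G]
    (k : ℕ) (hk : 2 ≤ k) (X : GSystem.{u} G) (hX : X.Ergodic) :
    ∃ (Y : GSystem.{u} G) (π : GSystem.FactorMap Y X), Y.Ergodic ∧ π.IsDivisibleIn k := by
  have : Countable (Shrink.{u} G) := Countable.of_equiv G (equivShrink.{u} G)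
  have hcount : ∀ i, Countable (X.Spec (i + 1)) := GSystem.countable_spec
  have : Nonempty (Σ i : ℕ, X.Spec (i + 1) × ℕ) := ⟨⟨0, 1, 0⟩⟩
  -- An entry `(i, l, n)` encodes degree `i + 1` and exponent `n + 1`, which excludes zero for both.
  obtain ⟨s, hs⟩ := exists_surjective_nat (Σ i : ℕ, X.Spec (i + 1) × ℕ)
  choose q hq hroot using fun t => GSystem.exists_root_symbol (s t).2.1 (s t).2.2.succ_ne_zero
  -- `Shrink` moves the countable group `G` to the universe of `X`, where `W` has to live.
  obtain ⟨W, _, _, _, _, _, m, _, hcont, hm, Q, hQ, hQq⟩ :=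
    GSystem.exists_polynomial_system (Shrink.addEquiv : Shrink.{u} G ≃+ G) (fun t => (s t).1 + 1) q hq
  obtain ⟨Y, π, θ, hY, hθ, hθG⟩ := GSystem.exists_ergodic_joining X hX W hcont m hm
  refine ⟨Y, π, hY, fun i hi _ n hn l => ?_⟩
  obtain ⟨i, rfl⟩ := Nat.exists_eq_add_of_le' hi
  obtain ⟨n, rfl⟩ := Nat.exists_eq_add_of_le' hn
  obtain ⟨t, ht⟩ := hs ⟨i, l, n⟩
  have hmem := GSystem.symbol_mem_spec (Y := Y) (q := q t) (Q := fun y => Q t (θ y))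
    ((hQ t).comp_aestronglyMeasurable hθ.aestronglyMeasurable) fun y => by
      obtain ⟨r, hr, hrq⟩ := hQq t (θ y)
      exact ⟨r, hr, fun a => by rw [hθG, hrq]⟩
  have hpow := hroot t
  rw [ht] at hmem hpow
  exact ⟨⟨_, hmem⟩, Subtype.ext (funext hpow)⟩
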